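/- Let $\Gamma$ be an Artin algebra, i.e. an algebra that is finitely generated as a module over a commutative Artinian ring, and let $n \ge 0$ be an integer. All modules are finitely generated left modules. For a $\Gamma$-module $M$ write $\operatorname{pd} M$ for its projective dimension (with $\operatorname{pd} 0 = -\infty$) and $\operatorname{soc} M$ for its socle, the sum of its simple submodules. Let $\operatorname{gldim}\Gamma$ be the supremum of $\operatorname{pd} M$ over all $\Gamma$-modules $M$, and let $\operatorname{domdim}\Gamma \in \{0,1,2,\dots,\infty\}$ be the supremum of all $m$ such that, in a minimal injective coresolution $0 \to \Gamma \to I_0 \to I_1 \to \cdots$ of the left regular module, $I_0, \dots, I_{m-1}$ are projective. The algebra $\Gamma$ is called an $n$-Auslander algebra if $\operatorname{gldim}\Gamma \le n+1 \le \operatorname{domdim}\Gamma$. Let $\operatorname{prinj}(\Gamma)$ be the class of $\Gamma$-modules that are both projective and injective. Suppose that $\operatorname{gldim}\Gamma = n+1$. Then $\Gamma$ is an $n$-Auslander algebra if and only if $$\operatorname{prinj}(\Gamma) = \{\, I \in \Gamma\text{-mod} \mid I \text{ is injective and } \operatorname{pd}(\operatorname{soc} I) \le n \,\}.$$ -/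

import Mathlib

noncomputable section

namespace ArtinAlg

open CategoryTheory

universe u

/-- The socle of a module: the sum of all its simple submodules. -/
def socle (Γ : Type u) [Ring Γ] (M : Type u) [AddCommGroup M] [Module Γ M] : Submodule Γ M :=
  sSup {S : Submodule Γ M | IsSimpleModule Γ S}

/-- A submodule is essential if it meets every nonzero submodule nontrivially. -/
def IsEssential {Γ : Type u} [Ring Γ] {M : Type u} [AddCommGroup M] [Module Γ M]
    (N : Submodule Γ M) : Prop :=
  ∀ K : Submodule Γ M, N ⊓ K = ⊥ → K = ⊥

/-- The global dimension of `Γ`: the supremum of the projective dimensions of the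
finitely generated left `Γ`-modules (the zero module has projective dimension `⊥`). -/
def globalDimension (Γ : Type u) [Ring Γ] : WithBot ℕ∞ :=
  ⨆ (M : ModuleCat.{u} Γ) (_ : Module.Finite Γ M), projectiveDimension M

/-- An injective coresolution `0 → M → I⁰ → I¹ → ⋯` is minimal if each kernel
`ker (Iⁱ → Iⁱ⁺¹)` is essential in `Iⁱ`. By exactness these kernels are the images of
`M → I⁰` and of `Iⁱ⁻¹ → Iⁱ`, so each `Iⁱ` is an injective envelope of the `i`-th cosyzygy. -/
def IsMinimalCoresolution {Γ : Type u} [Ring Γ] {M : ModuleCat.{u} Γ}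
    (R : InjectiveResolution M) : Prop :=
  ∀ i : ℕ, IsEssential (LinearMap.ker (R.cocomplex.d i (i + 1)).hom)

/-- The dominant dimension of `Γ`: the supremum of all `m` such that the first `m` terms
`I⁰, …, Iᵐ⁻¹` of a minimal injective coresolution of the left regular module are projective. -/
def dominantDimension (Γ : Type u) [Ring Γ] : ℕ∞ :=
  ⨆ (m : ℕ) (_ : ∃ R : InjectiveResolution (ModuleCat.of Γ Γ), IsMinimalCoresolution R ∧
    ∀ j < m, Module.Projective Γ (R.cocomplex.X j)), (m : ℕ∞)

/-- The condition `gldim Γ ≤ n + 1 ≤ domdim Γ` which defines the `n`-Auslander algebras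
among Artin algebras. -/
def IsAuslander (n : ℕ) (Γ : Type u) [Ring Γ] : Prop :=
  globalDimension Γ ≤ ((n + 1 : ℕ) : WithBot ℕ∞) ∧ ((n + 1 : ℕ) : ℕ∞) ≤ dominantDimension Γ

/-- The class of finitely generated projective-injective left `Γ`-modules. -/
def prinj (Γ : Type u) [Ring Γ] : ObjectProperty (ModuleCat.{u} Γ) :=
  fun I => Module.Finite Γ I ∧ Module.Projective Γ I ∧ Module.Injective Γ I

/-- The class of finitely generated injective left `Γ`-modules whose socle has projective
dimension at most `n`. -/
def injSoclePdLE (n : ℕ) (Γ : Type u) [Ring Γ] : ObjectProperty (ModuleCat.{u} Γ) :=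
  fun I => Module.Finite Γ I ∧ Module.Injective Γ I ∧
    projectiveDimension (ModuleCat.of Γ (socle Γ I)) ≤ (n : WithBot ℕ∞)

end ArtinAlg

end

/-!
A nonzero finitely generated module `X` with `pd X ≤ n` has `Extⁱ(X, Γ) ≠ 0` for some `i ≤ n`, so
by dimension shifting along the minimal injective coresolution `0 → Γ → I⁰ → I¹ → ⋯` it has a
nonzero map to some `Iʲ` with `j ≤ n`. If `n + 1 ≤ domdim Γ`, these `Iʲ` are projective. When `I` is
injective with `pd (soc I) ≤ n`, every simple submodule of `I` therefore survives under some map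
from `I` to a projective module. As `I` is Artinian, finitely many such maps embed `I` into a
projective module, from which it splits off.

If `I` is projective-injective and `gldim Γ ≤ n + 1`, then `I / soc I` has projective dimension at
most `n + 1`, so `pd (soc I) ≤ n`. The same estimate applied to `soc Iʲ ⊆ ker dʲ` gives the
converse by induction: `ker dʲ` has projective dimension at most `j ≤ n`, because it is `Γ` for
`j = 0` and otherwise the cokernel of `ker dʲ⁻¹ → Iʲ⁻¹` with `Iʲ⁻¹` projective. Since `ker dʲ` is
essential in `Iʲ`, it contains `soc Iʲ`, so `pd (soc Iʲ) ≤ n` and `Iʲ` is projective by hypothesis.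
That `Iʲ` is finitely generated follows from its filtration by the annihilators of the powers of
the Jacobson radical, whose first step is semisimple, hence contained in `ker dʲ`.
-/

namespace ArtinAlg

open CategoryTheory Abelian

universe u v w

section InjectiveHull

theorem exists_le_maximal_disjoint {α : Type*} [CompleteLattice α] [IsCompactlyGenerated α]
    {a b : α} (h : Disjoint a b) : ∃ c, b ≤ c ∧ Maximal (Disjoint a) c :=
  zorn_le_nonempty₀ {c | Disjoint a c}
    (fun s hs hchain _ _ => ⟨sSup s, hchain.directedOn.disjoint_sSup_right.2 fun _ hc => hs hc,
      fun _ hc => le_sSup hc⟩) b h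

variable {Γ : Type u} [Ring Γ]

-- An extension `q : I → I` of the inclusion of `E` that kills `K` has image `E`, by maximality of
-- `E`: the image meets `K` trivially because `q⁻¹ K = K`, by maximality of `K`.
theorem exists_retraction_of_maximal_disjoint {I : Type u} [AddCommGroup I] [Module Γ I]
    [Module.Injective Γ I] {E K : Submodule Γ I} (hE : Maximal (Disjoint K) E)
    (hK : Maximal (Disjoint E) K) : ∃ p : I →ₗ[Γ] E, ∀ x : E, p x = x := by
  have hinj : Function.Injective (K.mkQ ∘ₗ E.subtype) := by
    rw [← LinearMap.ker_eq_bot, LinearMap.ker_comp, Submodule.ker_mkQ]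
    exact Submodule.disjoint_iff_comap_eq_bot.1 hE.prop.symm
  obtain ⟨φ, hφ⟩ := Module.Injective.out (K.mkQ ∘ₗ E.subtype) hinj E.subtype
  let q : I →ₗ[Γ] I := φ ∘ₗ K.mkQ
  have hqE (x : E) : q x = x := hφ x
  have hqK {x : I} (hx : x ∈ K) : q x = 0 := by
    simp [q, (Submodule.Quotient.mk_eq_zero K).2 hx]
  have hcomap : K.comap q ≤ K := by
    refine hK.le_of_ge (Submodule.disjoint_def.2 fun x hxE hxK => ?_) fun x hx => ?_
    · rw [Submodule.mem_comap, hqE ⟨x, hxE⟩] at hxK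
      exact Submodule.disjoint_def.1 hE.prop x hxK hxE
    · rw [Submodule.mem_comap, hqK hx]
      exact K.zero_mem
  have hrange : LinearMap.range q ≤ E := by
    refine hE.le_of_ge (Submodule.disjoint_def.2 ?_) fun x hx => ⟨x, hqE ⟨x, hx⟩⟩
    rintro _ hx ⟨y, rfl⟩
    exact hqK (hcomap hx)
  exact ⟨q.codRestrict E fun x => hrange ⟨x, rfl⟩, fun x => Subtype.ext (hqE x)⟩

theorem isEssential_comap_subtype_of_maximal_disjoint {M : Type u} [AddCommGroup M] [Module Γ M]
    {N E K : Submodule Γ M} (hNE : N ≤ E) (hEK : Disjoint E K) (hK : Maximal (Disjoint N) K) :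
    IsEssential (N.comap E.subtype) := by
  intro L hL
  have hLE : L.map E.subtype ≤ E := Submodule.map_subtype_le E L
  have hNL : Disjoint N (L.map E.subtype) := by
    have h := congrArg (Submodule.map E.subtype) hL
    rwa [Submodule.map_inf _ E.subtype_injective, Submodule.map_comap_subtype,
      inf_eq_right.2 hNE, Submodule.map_bot, ← disjoint_iff] at h
  have hLK : L.map E.subtype ≤ K :=
    le_sup_left.trans (hK.2 (hNL.disjoint_sup_right_of_disjoint_sup_left
      (hEK.mono_left (sup_le hNE hLE))) le_sup_right)
  apply Submodule.map_injective_of_injective E.subtype_injective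
  rw [Submodule.map_bot, le_bot_iff.1 (hEK hLE hLK)]

theorem exists_injectiveHull (M : ModuleCat.{u} Γ) :
    ∃ (E : ModuleCat.{u} Γ) (f : M ⟶ E),
      Injective E ∧ Mono f ∧ IsEssential (LinearMap.range f.hom) := by
  let I := Injective.under M
  let N : Submodule Γ I := LinearMap.range (Injective.ι M).hom
  have : Module.Injective Γ I := by
    have : Injective (ModuleCat.of Γ I) := inferInstanceAs (Injective (Injective.under M))
    exact Module.injective_module_of_injective_object Γ I
  obtain ⟨K, -, hK⟩ := exists_le_maximal_disjoint (disjoint_bot_right (a := N))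
  obtain ⟨E, hNE, hE⟩ := exists_le_maximal_disjoint hK.prop.symm
  have hKE : Maximal (Disjoint E) K :=
    ⟨hE.prop.symm, fun L hL hKL => hK.2 (hL.mono_left hNE) hKL⟩
  obtain ⟨p, hp⟩ := exists_retraction_of_maximal_disjoint hE hKE
  let r : Retract (ModuleCat.of Γ E) I :=
    ⟨ModuleCat.ofHom E.subtype, ModuleCat.ofHom p, ModuleCat.hom_ext (LinearMap.ext hp)⟩
  have hM (x : M) : (Injective.ι M).hom x ∈ E := hNE ⟨x, rfl⟩
  refine ⟨ModuleCat.of Γ E, ModuleCat.ofHom ((Injective.ι M).hom.codRestrict E hM),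
    r.injective, ?_, ?_⟩
  · rw [ModuleCat.mono_iff_injective]
    intro x y hxy
    exact (ModuleCat.mono_iff_injective (Injective.ι M)).1 inferInstance (congrArg Subtype.val hxy)
  · rw [ModuleCat.hom_ofHom, LinearMap.range_codRestrict]
    exact isEssential_comap_subtype_of_maximal_disjoint hNE hE.prop.symm hK

end InjectiveHull

section Splicing

variable {C : Type u} [Category.{v} C] [Abelian C]

/-- A cochain complex of injective objects, made exact by a coaugmentation `f : Z ⟶ K⁰`, as an
injective resolution of `Z`. -/
noncomputable def injectiveResolutionOfExact {Z : C} (K : CochainComplex C ℕ)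
    (hK : ∀ j, Injective (K.X j)) (f : Z ⟶ K.X 0) (hf : Mono f) (w : f ≫ K.d 0 1 = 0)
    (h₀ : (ShortComplex.mk f (K.d 0 1) w).Exact) (hsucc : ∀ j, K.ExactAt (j + 1)) :
    InjectiveResolution Z where
  cocomplex := K
  injective := hK
  ι := (CochainComplex.fromSingle₀Equiv _ _).symm ⟨f, w⟩
  quasiIso := ⟨fun j => by
    cases j with
    | zero =>
      rw [CochainComplex.quasiIsoAt₀_iff, ShortComplex.quasiIso_iff_of_zeros]
      · refine (ShortComplex.exact_and_mono_f_iff_of_iso ?_).2 ⟨h₀, hf⟩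
        exact ShortComplex.isoMk (Iso.refl _) (Iso.refl _) (Iso.refl _)
          ((Category.id_comp f).trans
            ((CochainComplex.fromSingle₀Equiv_symm_apply_f_zero f w).symm.trans
              (Category.comp_id _).symm))
          ((Category.id_comp _).trans (Category.comp_id _).symm)
      · rfl
      · rfl
      · exact K.shape 0 0 (by simp)
    | succ j =>
      rw [quasiIsoAt_iff_exactAt]
      · exact hsucc j
      · exact CochainComplex.exactAt_succ_single_obj _ _⟩

theorem exact_mk_comp {X₁ X₂ X₃ Y : C} {f : X₁ ⟶ X₂} {g : X₂ ⟶ X₃} {w : f ≫ g = 0}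
    (h : (ShortComplex.mk f g w).Exact) {m : X₃ ⟶ Y} (hm : Mono m) (w' : f ≫ g ≫ m = 0) :
    (ShortComplex.mk f (g ≫ m) w').Exact := by
  let φ : ShortComplex.mk f g w ⟶ ShortComplex.mk f (g ≫ m) w' :=
    { τ₁ := 𝟙 _, τ₂ := 𝟙 _, τ₃ := m }
  exact (ShortComplex.exact_iff_of_epi_of_isIso_of_mono φ).1 h

theorem exact_comp_mk {X₁ X₂ X₃ Y : C} {f : X₁ ⟶ X₂} {g : X₂ ⟶ X₃} {w : f ≫ g = 0}
    (h : (ShortComplex.mk f g w).Exact) {e : Y ⟶ X₁} (he : Epi e) (w' : (e ≫ f) ≫ g = 0) :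
    (ShortComplex.mk (e ≫ f) g w').Exact := by
  let φ : ShortComplex.mk (e ≫ f) g w' ⟶ ShortComplex.mk f g w :=
    { τ₁ := e, τ₂ := 𝟙 _, τ₃ := 𝟙 _ }
  exact (ShortComplex.exact_iff_of_epi_of_isIso_of_mono φ).2 h

variable {Z I : ℕ → C} {i : ∀ j, Z j ⟶ I j} {p : ∀ j, I j ⟶ Z (j + 1)}
  (w : ∀ j, i j ≫ p j = 0)

/-- The cochain complex `I⁰ → I¹ → ⋯` spliced together from the complexes `Zʲ → Iʲ → Zʲ⁺¹`. -/
noncomputable abbrev splicedComplex : CochainComplex C ℕ :=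
  CochainComplex.of I (fun j => p j ≫ i (j + 1)) fun j => by
    rw [Category.assoc, reassoc_of% w (j + 1), Limits.zero_comp, Limits.comp_zero]

theorem splicedComplex_d (j : ℕ) : (splicedComplex w).d j (j + 1) = p j ≫ i (j + 1) :=
  CochainComplex.of_d I (fun j => p j ≫ i (j + 1)) j

variable {w}

theorem splicedComplex_exactAt_succ (hS : ∀ j, (ShortComplex.mk (i j) (p j) (w j)).ShortExact)
    (j : ℕ) : (splicedComplex w).ExactAt (j + 1) := by
  rw [HomologicalComplex.exactAt_iff' _ j (j + 1) (j + 1 + 1) (by simp) (by simp)]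
  simp only [HomologicalComplex.sc', HomologicalComplex.shortComplexFunctor', CochainComplex.of_d]
  exact exact_comp_mk (exact_mk_comp (hS (j + 1)).exact (hS (j + 2)).mono_f
    (by rw [reassoc_of% w (j + 1), Limits.zero_comp])) (hS j).epi_g _

/-- The injective resolution of `Z⁰` spliced together from short exact sequences
`0 → Zʲ → Iʲ → Zʲ⁺¹ → 0` with injective middle terms. -/
noncomputable def splicedResolution (hI : ∀ j, Injective (I j))
    (hS : ∀ j, (ShortComplex.mk (i j) (p j) (w j)).ShortExact) : InjectiveResolution (Z 0) :=
  injectiveResolutionOfExact (splicedComplex w) hI (i 0) (hS 0).mono_f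
    (by rw [← zero_add 1, splicedComplex_d, reassoc_of% w 0, Limits.zero_comp])
    (by
      convert exact_mk_comp (hS 0).exact (hS 1).mono_f (by rw [reassoc_of% w 0, Limits.zero_comp])
      exact splicedComplex_d w 0)
    (splicedComplex_exactAt_succ hS)

end Splicing

section MinimalCoresolution

variable {Γ : Type u} [Ring Γ]

theorem isMinimalCoresolution_splicedResolution {Z I : ℕ → ModuleCat.{u} Γ} {i : ∀ j, Z j ⟶ I j}
    {p : ∀ j, I j ⟶ Z (j + 1)} {w : ∀ j, i j ≫ p j = 0} (hI : ∀ j, Injective (I j))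
    (hS : ∀ j, (ShortComplex.mk (i j) (p j) (w j)).ShortExact)
    (hess : ∀ j, IsEssential (LinearMap.range (i j).hom)) :
    IsMinimalCoresolution (splicedResolution hI hS) := by
  intro j
  have hrange : LinearMap.range (i j).hom = LinearMap.ker (p j).hom :=
    (ShortComplex.moduleCat_exact_iff_range_eq_ker _).1 (hS j).exact
  have hmono : LinearMap.ker (i (j + 1)).hom = ⊥ :=
    (ModuleCat.mono_iff_ker_eq_bot _).1 (hS (j + 1)).mono_f
  change IsEssential (LinearMap.ker ((splicedComplex w).d j (j + 1)).hom)
  rw [splicedComplex_d, ModuleCat.hom_comp, LinearMap.ker_comp_of_ker_eq_bot _ hmono, ← hrange]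
  exact hess j

theorem exists_isMinimalCoresolution (M : ModuleCat.{u} Γ) :
    ∃ R : InjectiveResolution M, IsMinimalCoresolution R := by
  choose E ι hE hι hess using exists_injectiveHull (Γ := Γ)
  let Ω (N : ModuleCat.{u} Γ) : ModuleCat.{u} Γ := Limits.cokernel (ι N)
  let π (N : ModuleCat.{u} Γ) : E N ⟶ Ω N := Limits.cokernel.π (ι N)
  have w (N : ModuleCat.{u} Γ) : ι N ≫ π N = 0 := Limits.cokernel.condition (ι N)
  have hS (N : ModuleCat.{u} Γ) : (ShortComplex.mk (ι N) (π N) (w N)).ShortExact :=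
    { exact := ShortComplex.exact_cokernel (ι N)
      mono_f := hι N
      epi_g := inferInstanceAs (Epi (Limits.cokernel.π (ι N))) }
  let Z (j : ℕ) : ModuleCat.{u} Γ := Nat.rec M (fun _ N => Ω N) j
  exact ⟨splicedResolution (fun j => hE (Z j)) fun j => hS (Z j),
    isMinimalCoresolution_splicedResolution _ (fun j => hS (Z j)) fun j => hess (Z j)⟩

end MinimalCoresolution

section EssentialExtension

variable {Γ : Type u} [Ring Γ]

theorem IsEssential.le_of_isSemisimpleModule {M : Type u} [AddCommGroup M] [Module Γ M]
    {N : Submodule Γ M} (hN : IsEssential N) (T : Submodule Γ M) [IsSemisimpleModule Γ T] :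
    T ≤ N := by
  obtain ⟨C, hC⟩ := exists_isCompl (N.comap T.subtype)
  have hNC : N ⊓ C.map T.subtype = ⊥ := by
    rw [Submodule.eq_bot_iff]
    rintro _ ⟨hxN, x, hx, rfl⟩
    exact congrArg T.subtype (Submodule.disjoint_def.1 hC.disjoint x hxN hx)
  have hbot : C = ⊥ := Submodule.map_injective_of_injective T.injective_subtype
    ((hN _ hNC).trans (Submodule.map_bot _).symm)
  exact Submodule.comap_subtype_eq_top.1 (eq_top_of_isCompl_bot (hbot ▸ hC))

/-- The submodule of `M` formed by the elements annihilated by the two-sided ideal `J`. For the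
powers of the Jacobson radical of a semiprimary ring these form a finite filtration of `M`. -/
def annihilatedBy (J : Ideal Γ) [J.IsTwoSided] (M : Type v) [AddCommGroup M] [Module Γ M] :
    Submodule Γ M where
  carrier := {x | ∀ a ∈ J, a • x = 0}
  add_mem' hx hy a ha := by rw [smul_add, hx a ha, hy a ha, add_zero]
  zero_mem' a _ := smul_zero a
  smul_mem' c x hx a ha := by rw [smul_smul, hx _ (J.mul_mem_right c ha)]

theorem mem_annihilatedBy_span {M : Type v} [AddCommGroup M] [Module Γ M] {s : Set Γ}
    [(Ideal.span s).IsTwoSided] {x : M} :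
    x ∈ annihilatedBy (Ideal.span s) M ↔ ∀ a ∈ s, a • x = 0 :=
  Ideal.span_le (I := LinearMap.ker (LinearMap.toSpanSingleton Γ M x))

theorem annihilatedBy_eq_bot {J : Ideal Γ} [J.IsTwoSided] (hJ : J = ⊤) (M : Type v)
    [AddCommGroup M] [Module Γ M] : annihilatedBy J M = ⊥ :=
  (Submodule.eq_bot_iff _).2 fun x hx =>
    (one_smul Γ x).symm.trans (hx 1 ((Ideal.eq_top_iff_one J).1 hJ))

theorem annihilatedBy_eq_top {J : Ideal Γ} [J.IsTwoSided] (hJ : J = ⊥) (M : Type v)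
    [AddCommGroup M] [Module Γ M] : annihilatedBy J M = ⊤ :=
  eq_top_iff.2 fun x _ a ha => by rw [(Submodule.eq_bot_iff J).1 hJ a ha, zero_smul]

instance isSemisimpleModule_annihilatedBy (J : Ideal Γ) [J.IsTwoSided] [IsSemisimpleRing (Γ ⧸ J)]
    (M : Type v) [AddCommGroup M] [Module Γ M] : IsSemisimpleModule Γ (annihilatedBy J M) := by
  have htors : Module.IsTorsionBySet Γ (annihilatedBy J M) (J : Set Γ) :=
    fun x a => Subtype.ext (x.2 a a.2)
  let _ := htors.module
  exact (htors.semilinearMap.isSemisimpleModule_iff_of_bijective Function.bijective_id).2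
    inferInstance

theorem isNoetherian_annihilatedBy_pow (k : Type*) [CommRing k] [Algebra k Γ] {J : Ideal Γ}
    [J.IsTwoSided] (hJ : J.FG) (M : Type v) [AddCommGroup M] [Module Γ M] [Module k M]
    [IsScalarTower k Γ M] [IsNoetherian k (annihilatedBy J M)] (i : ℕ) :
    IsNoetherian k (annihilatedBy (J ^ i) M) := by
  have : SMulCommClass k Γ M := IsScalarTower.to_smulCommClass
  obtain ⟨s, rfl⟩ := hJ
  set J := Ideal.span (s : Set Γ)
  induction i with
  | zero =>
    rw [annihilatedBy_eq_bot ((Submodule.pow_zero _).trans Ideal.one_eq_top)]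
    infer_instance
  | succ i ih =>
    have hmem (x : annihilatedBy (J ^ (i + 1)) M) (a : s) :
        (a : Γ) • (x : M) ∈ annihilatedBy (J ^ i) M := by
      intro b hb
      rw [smul_smul]
      exact x.2 _ (Ideal.mul_mem_mul hb (Ideal.subset_span a.2))
    -- Multiplication by the generators of `J` maps into copies of the previous stage, and its
    -- kernel is annihilated by `J`.
    let φ : annihilatedBy (J ^ (i + 1)) M →ₗ[k] (s → annihilatedBy (J ^ i) M) :=
      { toFun := fun x a => ⟨(a : Γ) • (x : M), hmem x a⟩
        map_add' := fun x y => funext fun a => Subtype.ext (smul_add _ _ _)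
        map_smul' := fun c x => funext fun a => Subtype.ext (smul_comm _ _ _) }
    have hker (x : LinearMap.ker φ) : (x : M) ∈ annihilatedBy J M :=
      mem_annihilatedBy_span.2 fun a ha => congrArg Subtype.val (congrFun x.2 ⟨a, ha⟩)
    let ι : LinearMap.ker φ →ₗ[k] annihilatedBy J M :=
      { toFun := fun x => ⟨x, hker x⟩
        map_add' := fun _ _ => rfl
        map_smul' := fun _ _ => rfl }
    have : IsNoetherian k (LinearMap.ker φ) := isNoetherian_of_injective ι fun x y hxy =>
      Subtype.ext (Subtype.ext (Subtype.mk.inj hxy))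
    exact isNoetherian_of_range_eq_ker (LinearMap.ker φ).subtype φ (Submodule.range_subtype _)

theorem finite_of_isEssential (k : Type*) [CommRing k] [IsNoetherianRing k] [Algebra k Γ]
    [Module.Finite k Γ] [IsSemiprimaryRing Γ] {M : Type u} [AddCommGroup M] [Module Γ M]
    {N : Submodule Γ M} [Module.Finite Γ N] (hN : IsEssential N) : Module.Finite Γ M := by
  let _ : Module k M := Module.compHom M (algebraMap k Γ)
  have : IsScalarTower k Γ M := .of_algebraMap_smul fun _ _ => rfl
  have : IsNoetherianRing Γ := .of_finite k Γ
  have : Module.Finite k N := .trans Γ N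
  have hle := hN.le_of_isSemisimpleModule (annihilatedBy (Ring.jacobson Γ) M)
  have : IsNoetherian k (annihilatedBy (Ring.jacobson Γ) M) :=
    isNoetherian_of_injective ((Submodule.inclusion hle).restrictScalars k)
      (Submodule.inclusion_injective hle)
  obtain ⟨i, hi⟩ := IsSemiprimaryRing.isNilpotent (R := Γ)
  have h : IsNoetherian k (annihilatedBy (Ring.jacobson Γ ^ i) M) :=
    isNoetherian_annihilatedBy_pow k (IsNoetherian.noetherian _) M i
  rw [annihilatedBy_eq_top hi] at h
  have : Module.Finite Γ (⊤ : Submodule Γ M) := .of_restrictScalars_finite k Γ _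
  exact .equiv Submodule.topEquiv

end EssentialExtension

section Ext

variable {C : Type u} [Category.{v} C] [Abelian C] [HasExt.{w} C]

theorem subsingleton_ext_of_retract (X : C) {Y Y' : C} (r : Retract Y Y') (i : ℕ)
    [Subsingleton (Ext X Y' i)] : Subsingleton (Ext X Y i) := by
  refine subsingleton_of_forall_eq 0 fun e => ?_
  have he : e.comp (Ext.mk₀ r.i) (add_zero i) = 0 := Subsingleton.elim _ _
  rw [← e.comp_mk₀_id, ← r.retract, ← Ext.mk₀_comp_mk₀, ← Ext.comp_assoc_of_second_deg_zero, he,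
    Ext.zero_comp]

variable {S : ShortComplex C}

theorem subsingleton_ext_X₁_of_projective_X₂ (hS : S.ShortExact) (Y : C) (i : ℕ) [Projective S.X₂]
    [Subsingleton (Ext S.X₃ Y (i + 2))] : Subsingleton (Ext S.X₁ Y (i + 1)) := by
  refine subsingleton_of_forall_eq 0 fun e => ?_
  obtain ⟨e', rfl⟩ := Ext.contravariant_sequence_exact₁ hS Y e (n₁ := i + 2) (add_comm _ _)
    (Subsingleton.elim _ _)
  rw [e'.eq_zero_of_projective, Ext.comp_zero]

theorem subsingleton_ext_X₁_of_injective_X₂ (hS : S.ShortExact) (X : C) (i : ℕ) [Injective S.X₂]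
    [Subsingleton (Ext X S.X₃ i)] : Subsingleton (Ext X S.X₁ (i + 1)) := by
  refine subsingleton_of_forall_eq 0 fun e => ?_
  obtain ⟨e', rfl⟩ := Ext.covariant_sequence_exact₁ X hS e (Ext.eq_zero_of_injective _) rfl
  rw [Subsingleton.elim e' 0, Ext.zero_comp]

theorem subsingleton_hom_of_subsingleton_ext_zero (X Y : C) [Subsingleton (Ext X Y 0)] :
    Subsingleton (X ⟶ Y) :=
  Ext.homEquiv₀.symm.subsingleton

theorem projective_X₃_of_subsingleton_ext_one (hS : S.ShortExact) [Projective S.X₂]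
    [Subsingleton (Ext S.X₃ S.X₁ 1)] : Projective S.X₃ := by
  obtain ⟨e, he⟩ := Ext.covariant_sequence_exact₃ S.X₃ hS (Ext.mk₀ (𝟙 S.X₃)) (zero_add 1)
    (Subsingleton.elim _ _)
  obtain ⟨s, rfl⟩ := Ext.homEquiv₀.symm.surjective e
  have hs : s ≫ S.g = 𝟙 S.X₃ := Ext.homEquiv₀.symm.injective (by simpa using he)
  exact Retract.projective ⟨s, S.g, hs⟩

end Ext

section ExtSelf

variable {Γ : Type u} [Ring Γ]

theorem exists_retract_pi (P : ModuleCat.{u} Γ) [Module.Finite Γ P] [Projective P] :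
    ∃ m : ℕ, Nonempty (Retract P (ModuleCat.of Γ (Fin m → Γ))) := by
  obtain ⟨m, f, hf⟩ := Module.Finite.exists_fin' Γ P
  have : Epi (ModuleCat.ofHom f) := (ModuleCat.epi_iff_surjective _).2 hf
  exact ⟨m, ⟨Projective.factorThru (𝟙 P) (ModuleCat.ofHom f), ModuleCat.ofHom f,
    Projective.factorThru_comp _ _⟩⟩

theorem subsingleton_ext_of_projective (X P : ModuleCat.{u} Γ) [Module.Finite Γ P] [Projective P]
    (i : ℕ) [Subsingleton (Ext X (ModuleCat.of Γ Γ) i)] : Subsingleton (Ext X P i) := by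
  obtain ⟨m, ⟨r⟩⟩ := exists_retract_pi P
  let F (_ : Fin m) : ModuleCat.{u} Γ := ModuleCat.of Γ Γ
  have (j : Fin m) : Subsingleton (Ext X (F j) i) := ‹_›
  have : Subsingleton (Ext X (⨁ F) i) :=
    (Ext.addEquivBiproduct X (Limits.biproduct.isBilimit F) i).subsingleton
  exact subsingleton_ext_of_retract X (r.trans (Retract.ofIso (ModuleCat.biproductIsoPi F).symm)) i

theorem hasProjectiveDimensionLT_of_subsingleton_ext_self [IsNoetherianRing Γ]
    (X : ModuleCat.{u} Γ) [Module.Finite Γ X] (d : ℕ) [HasProjectiveDimensionLT X (d + 1)]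
    [Subsingleton (Ext X (ModuleCat.of Γ Γ) d)] : HasProjectiveDimensionLT X d := by
  induction d generalizing X with
  | zero =>
    have : Projective X := projective_iff_hasProjectiveDimensionLT_one.2 ‹_›
    have := subsingleton_ext_of_projective X X 0
    have := subsingleton_hom_of_subsingleton_ext_zero X X
    rw [hasProjectiveDimensionLT_zero_iff_isZero, Limits.IsZero.iff_id_eq_zero]
    exact Subsingleton.elim _ _
  | succ d ih =>
    obtain ⟨m, f, hf⟩ := Module.Finite.exists_fin' Γ X
    let S : ShortComplex (ModuleCat.{u} Γ) := f.shortComplexKer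
    have hS : S.ShortExact := LinearMap.shortExact_shortComplexKer hf
    have hP : Projective S.X₂ := (IsProjective.iff_projective (R := Γ) (Fin m → Γ)).1 inferInstance
    have hfin : Module.Finite Γ S.X₁ := Module.Finite.of_fg (IsNoetherian.noetherian _)
    have hK : HasProjectiveDimensionLT S.X₁ (d + 1) :=
      (hS.hasProjectiveDimensionLT_X₃_iff d hP).1 ‹_›
    cases d with
    | zero =>
      have : Projective S.X₁ := projective_iff_hasProjectiveDimensionLT_one.2 hK
      have : Subsingleton (Ext S.X₃ S.X₁ 1) := subsingleton_ext_of_projective X S.X₁ 1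
      exact projective_iff_hasProjectiveDimensionLT_one.1
        (projective_X₃_of_subsingleton_ext_one hS)
    | succ d =>
      have : Subsingleton (Ext S.X₃ (ModuleCat.of Γ Γ) (d + 2)) := ‹_›
      have := subsingleton_ext_X₁_of_projective_X₂ hS (ModuleCat.of Γ Γ) d
      exact (hS.hasProjectiveDimensionLT_X₃_iff d hP).2 (ih S.X₁)

theorem subsingleton_of_subsingleton_ext_self [IsNoetherianRing Γ] (X : ModuleCat.{u} Γ)
    [Module.Finite Γ X] (d : ℕ) (hX : HasProjectiveDimensionLT X d)
    (h : ∀ i < d, Subsingleton (Ext X (ModuleCat.of Γ Γ) i)) : Subsingleton X := by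
  induction d with
  | zero => exact ModuleCat.isZero_iff_subsingleton.1 (isZero_of_hasProjectiveDimensionLT_zero X)
  | succ d ih =>
    have := h d d.lt_succ_self
    exact ih (hasProjectiveDimensionLT_of_subsingleton_ext_self X d)
      fun i hi => h i (hi.trans d.lt_succ_self)

end ExtSelf

section Cosyzygy

variable {Γ : Type u} [Ring Γ] {M : ModuleCat.{u} Γ}

/-- The short exact sequence `0 → ker dʲ → Iʲ → ker dʲ⁺¹ → 0` of an injective resolution, along
which dimensions are shifted; the kernels stand for the cosyzygies. -/
noncomputable def cosyzygyShortComplex (R : InjectiveResolution M) (j : ℕ) :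
    ShortComplex (ModuleCat.{u} Γ) where
  X₁ := ModuleCat.of Γ (LinearMap.ker (R.cocomplex.d j (j + 1)).hom)
  X₂ := R.cocomplex.X j
  X₃ := ModuleCat.of Γ (LinearMap.ker (R.cocomplex.d (j + 1) (j + 2)).hom)
  f := ModuleCat.ofHom (LinearMap.ker (R.cocomplex.d j (j + 1)).hom).subtype
  g := ModuleCat.ofHom ((R.cocomplex.d j (j + 1)).hom.codRestrict _ fun x =>
    congr($(R.cocomplex.d_comp_d j (j + 1) (j + 2)) x))
  zero := ModuleCat.hom_ext (LinearMap.ext fun x => Subtype.ext x.2)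

theorem shortExact_cosyzygyShortComplex (R : InjectiveResolution M) (j : ℕ) :
    (cosyzygyShortComplex R j).ShortExact where
  exact := (ShortComplex.moduleCat_exact_iff _).2 fun x hx => ⟨⟨x, congrArg Subtype.val hx⟩, rfl⟩
  mono_f := (ModuleCat.mono_iff_injective _).2 (Submodule.injective_subtype _)
  epi_g := by
    rw [ModuleCat.epi_iff_surjective]
    rintro ⟨x, hx⟩
    obtain ⟨y, hy⟩ := (ShortComplex.moduleCat_exact_iff _).1 (R.exact_succ j) x hx
    exact ⟨y, Subtype.ext hy⟩

/-- An injective resolution of `M` identifies `M` with the kernel of its first differential. -/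
noncomputable def kerIso (R : InjectiveResolution M) :
    ModuleCat.of Γ (LinearMap.ker (R.cocomplex.d 0 1).hom) ≅ M :=
  (ModuleCat.kernelIsLimit _).conePointUniqueUpToIso R.isLimitKernelFork

theorem subsingleton_ext_of_subsingleton_hom (R : InjectiveResolution M) (X : ModuleCat.{u} Γ)
    {n : ℕ} (h : ∀ j ≤ n, Subsingleton (X ⟶ R.cocomplex.X j)) {i : ℕ} (hi : i ≤ n) :
    Subsingleton (Ext X M i) := by
  have key (i : ℕ) : ∀ j, i + j ≤ n → Subsingleton (Ext X (cosyzygyShortComplex R j).X₁ i) := by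
    induction i with
    | zero =>
      intro j hj
      have hmono := (shortExact_cosyzygyShortComplex R j).mono_f
      have : Subsingleton (X ⟶ (cosyzygyShortComplex R j).X₂) := h j (by lia)
      have : Subsingleton (X ⟶ (cosyzygyShortComplex R j).X₁) :=
        ⟨fun f g => (cancel_mono (cosyzygyShortComplex R j).f).1 (Subsingleton.elim _ _)⟩
      exact Ext.homEquiv₀.subsingleton
    | succ i ih =>
      intro j hj
      have : Injective (cosyzygyShortComplex R j).X₂ := R.injective j
      have : Subsingleton (Ext X (cosyzygyShortComplex R j).X₃ i) := ih (j + 1) (by lia)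
      exact subsingleton_ext_X₁_of_injective_X₂ (shortExact_cosyzygyShortComplex R j) X i
  have : Subsingleton (Ext X (ModuleCat.of Γ (LinearMap.ker (R.cocomplex.d 0 1).hom)) i) :=
    key i 0 hi
  exact subsingleton_ext_of_retract X (Retract.ofIso (kerIso R).symm) i

theorem exists_hom_cocomplex_X_ne_zero [IsNoetherianRing Γ]
    (R : InjectiveResolution (ModuleCat.of Γ Γ)) (X : ModuleCat.{u} Γ) [Module.Finite Γ X]
    [Nontrivial X] (n : ℕ) [HasProjectiveDimensionLE X n] :
    ∃ j ≤ n, ∃ f : X ⟶ R.cocomplex.X j, f ≠ 0 := by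
  by_contra! h
  have := subsingleton_of_subsingleton_ext_self X (n + 1) ‹_› fun i hi =>
    subsingleton_ext_of_subsingleton_hom R X (fun j hj => subsingleton_of_forall_eq 0 (h j hj))
      (Nat.le_of_lt_succ hi)
  exact false_of_nontrivial_of_subsingleton X

end Cosyzygy

section GlobalDimension

variable {Γ : Type u} [Ring Γ]

theorem hasProjectiveDimensionLE_of_globalDimension_le {n : ℕ}
    (hgl : globalDimension Γ ≤ (n : WithBot ℕ∞)) (M : ModuleCat.{u} Γ) [Module.Finite Γ M] :
    HasProjectiveDimensionLE M n :=
  (projectiveDimension_le_iff M n).1 ((le_iSup₂_of_le M ‹_› le_rfl).trans hgl)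

theorem hasProjectiveDimensionLE_of_mono {n : ℕ}
    (hgl : globalDimension Γ ≤ ((n + 1 : ℕ) : WithBot ℕ∞)) {A B : ModuleCat.{u} Γ} (f : A ⟶ B)
    [Mono f] [Module.Finite Γ B] [HasProjectiveDimensionLE B n] :
    HasProjectiveDimensionLE A n := by
  have hS : (ShortComplex.mk f (Limits.cokernel.π f) (Limits.cokernel.condition f)).ShortExact :=
    { exact := ShortComplex.exact_cokernel f }
  have : Module.Finite Γ (Limits.cokernel f : ModuleCat.{u} Γ) :=
    .of_surjective (Limits.cokernel.π f).hom
      ((ModuleCat.epi_iff_surjective (Limits.cokernel.π f)).1 inferInstance)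
  exact hS.hasProjectiveDimensionLT_X₁ (n + 1) ‹_›
    (hasProjectiveDimensionLE_of_globalDimension_le hgl _)

end GlobalDimension

section Socle

variable {Γ : Type u} [Ring Γ]

theorem isSemisimpleModule_socle (M : Type u) [AddCommGroup M] [Module Γ M] :
    IsSemisimpleModule Γ (socle Γ M) := by
  rw [socle, sSup_eq_iSup]
  exact isSemisimpleModule_biSup_of_isSemisimpleModule_submodule fun S hS => by
    have : IsSimpleModule Γ S := hS
    infer_instance

theorem hasProjectiveDimensionLT_of_le {M : Type u} [AddCommGroup M] [Module Γ M]
    {S N : Submodule Γ M} [IsSemisimpleModule Γ N] (hSN : S ≤ N) (n : ℕ)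
    [HasProjectiveDimensionLT (ModuleCat.of Γ N) n] :
    HasProjectiveDimensionLT (ModuleCat.of Γ S) n := by
  obtain ⟨p, hp⟩ := IsSemisimpleModule.extension_property (Submodule.inclusion hSN)
    (Submodule.inclusion_injective hSN) LinearMap.id
  let r : Retract (ModuleCat.of Γ S) (ModuleCat.of Γ N) :=
    ⟨ModuleCat.ofHom (Submodule.inclusion hSN), ModuleCat.ofHom p, ModuleCat.hom_ext hp⟩
  exact r.hasProjectiveDimensionLT n

theorem prinj_le_injSoclePdLE {n : ℕ}
    (hgl : globalDimension Γ ≤ ((n + 1 : ℕ) : WithBot ℕ∞)) : prinj Γ ≤ injSoclePdLE n Γ := by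
  rintro I ⟨hfin, hproj, hinj⟩
  have : Projective I := (IsProjective.iff_projective (R := Γ) I).1 hproj
  have : HasProjectiveDimensionLE I n := hasProjectiveDimensionLT_of_ge I 1 (n + 1) (by lia)
  let f : ModuleCat.of Γ (socle Γ I) ⟶ I := ModuleCat.ofHom (socle Γ I).subtype
  have : Mono f := (ModuleCat.mono_iff_injective f).2 (socle Γ I).subtype_injective
  exact ⟨hfin, hinj, (projectiveDimension_le_iff _ n).2 (hasProjectiveDimensionLE_of_mono hgl f)⟩

end Socle

section DominantDimension

variable {Γ : Type u} [Ring Γ]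

theorem natCast_le_dominantDimension_iff {m : ℕ} :
    (m : ℕ∞) ≤ dominantDimension Γ ↔ ∃ R : InjectiveResolution (ModuleCat.of Γ Γ),
      IsMinimalCoresolution R ∧ ∀ j < m, Module.Projective Γ (R.cocomplex.X j) := by
  refine ⟨fun h => ?_, fun h => le_iSup₂_of_le m h le_rfl⟩
  cases m with
  | zero =>
    obtain ⟨R, hR⟩ := exists_isMinimalCoresolution (ModuleCat.of Γ Γ)
    exact ⟨R, hR, fun j hj => absurd hj j.not_lt_zero⟩
  | succ m =>
    have hlt : (m : ℕ∞) < dominantDimension Γ := (Nat.cast_lt.2 m.lt_succ_self).trans_le h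
    obtain ⟨l, hl⟩ := lt_iSup_iff.1 hlt
    obtain ⟨⟨R, hR, hproj⟩, hml⟩ := lt_iSup_iff.1 hl
    exact ⟨R, hR, fun j hj => hproj j (hj.trans_le (Nat.cast_lt.1 hml))⟩

theorem projective_of_forall_simple {I : Type u} [AddCommGroup I] [Module Γ I] [IsArtinian Γ I]
    [Module.Injective Γ I]
    (h : ∀ S : Submodule Γ I, IsSimpleModule Γ S → ∃ (P : ModuleCat.{u} Γ) (g : I →ₗ[Γ] P),
      Module.Projective Γ P ∧ ¬ S ≤ LinearMap.ker g) : Module.Projective Γ I := by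
  let A : Set (Submodule Γ I) := {K | ∃ (P : ModuleCat.{u} Γ) (g : I →ₗ[Γ] P),
    Module.Projective Γ P ∧ LinearMap.ker g = K}
  have hA : A.Nonempty :=
    ⟨⊤, ModuleCat.of Γ PUnit.{u + 1}, 0, inferInstanceAs (Module.Projective Γ PUnit.{u + 1}),
      LinearMap.ker_zero⟩
  obtain ⟨K, ⟨P, φ, hP, rfl⟩, hmin⟩ := IsArtinian.set_has_minimal A hA
  have hbot : LinearMap.ker φ = ⊥ := by
    by_contra hne
    obtain ⟨S, hS, hSφ⟩ := (eq_bot_or_exists_atom_le (LinearMap.ker φ)).resolve_left hne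
    obtain ⟨Q, g, hQ, hSg⟩ := h S (isSimpleModule_iff_isAtom.2 hS)
    refine hmin (LinearMap.ker (φ.prod g)) ⟨ModuleCat.of Γ (P × Q), φ.prod g,
      inferInstanceAs (Module.Projective Γ (P × Q)), rfl⟩ ?_
    rw [LinearMap.ker_prod]
    exact inf_lt_left.2 fun hle => hSg (hSφ.trans hle)
  obtain ⟨p, hp⟩ := Module.Injective.out φ (LinearMap.ker_eq_bot.1 hbot) LinearMap.id
  exact Module.Projective.of_split φ p (LinearMap.ext hp)

theorem injSoclePdLE_le_prinj [IsArtinianRing Γ] {n : ℕ}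
    (hdom : ((n + 1 : ℕ) : ℕ∞) ≤ dominantDimension Γ) : injSoclePdLE n Γ ≤ prinj Γ := by
  rintro I ⟨hfin, hinj, hpd⟩
  obtain ⟨R, -, hR⟩ := natCast_le_dominantDimension_iff.1 hdom
  refine ⟨hfin, projective_of_forall_simple fun S hS => ?_, hinj⟩
  have := isSemisimpleModule_socle (Γ := Γ) I
  have : HasProjectiveDimensionLE (ModuleCat.of Γ (socle Γ I)) n :=
    (projectiveDimension_le_iff _ n).1 hpd
  have hS' : S ≤ socle Γ I := le_sSup hS
  have : HasProjectiveDimensionLE (ModuleCat.of Γ S) n := hasProjectiveDimensionLT_of_le hS' (n + 1)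
  have : Module.Finite Γ (ModuleCat.of Γ S) := inferInstanceAs (Module.Finite Γ S)
  have : Nontrivial (ModuleCat.of Γ S) := IsSimpleModule.nontrivial Γ S
  obtain ⟨j, hj, f, hf⟩ := exists_hom_cocomplex_X_ne_zero R (ModuleCat.of Γ S) n
  have : Mono (ModuleCat.ofHom S.subtype) :=
    (ModuleCat.mono_iff_injective _).2 S.subtype_injective
  have := R.injective j
  let g := Injective.factorThru f (ModuleCat.ofHom S.subtype)
  have hg : ModuleCat.ofHom S.subtype ≫ g = f := Injective.comp_factorThru _ _
  refine ⟨R.cocomplex.X j, g.hom, hR j (Nat.lt_succ_of_le hj), fun hle => hf ?_⟩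
  rw [← hg]
  exact ModuleCat.hom_ext (LinearMap.ext fun x => hle x.2)

theorem prinj_of_isEssential (k : Type*) [CommRing k] [IsNoetherianRing k] [Algebra k Γ]
    [Module.Finite k Γ] [IsSemiprimaryRing Γ] {n : ℕ}
    (hgl : globalDimension Γ ≤ ((n + 1 : ℕ) : WithBot ℕ∞)) (h : injSoclePdLE n Γ ≤ prinj Γ)
    {I : ModuleCat.{u} Γ} (hI : Module.Injective Γ I) {N : Submodule Γ I} (hN : IsEssential N)
    [Module.Finite Γ N] [HasProjectiveDimensionLE (ModuleCat.of Γ N) n] : prinj Γ I := by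
  have := isSemisimpleModule_socle (Γ := Γ) I
  have hle : socle Γ I ≤ N := hN.le_of_isSemisimpleModule (socle Γ I)
  let f : ModuleCat.of Γ (socle Γ I) ⟶ ModuleCat.of Γ N :=
    ModuleCat.ofHom (Submodule.inclusion hle)
  have : Mono f := (ModuleCat.mono_iff_injective f).2 (Submodule.inclusion_injective hle)
  have : Module.Finite Γ (ModuleCat.of Γ N) := ‹_›
  exact h I ⟨finite_of_isEssential k hN, hI,
    (projectiveDimension_le_iff _ n).2 (hasProjectiveDimensionLE_of_mono hgl f)⟩

theorem projective_of_isMinimalCoresolution (k : Type*) [CommRing k] [IsNoetherianRing k]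
    [Algebra k Γ] [Module.Finite k Γ] [IsSemiprimaryRing Γ] {n : ℕ}
    (hgl : globalDimension Γ ≤ ((n + 1 : ℕ) : WithBot ℕ∞)) (h : injSoclePdLE n Γ ≤ prinj Γ)
    {M : ModuleCat.{u} Γ} [Module.Finite Γ M] [Projective M] {R : InjectiveResolution M}
    (hR : IsMinimalCoresolution R) {j : ℕ} (hj : j ≤ n) :
    Module.Projective Γ (R.cocomplex.X j) := by
  have hprinj (j : ℕ) (hfin : Module.Finite Γ (cosyzygyShortComplex R j).X₁)
      (hpd : HasProjectiveDimensionLE (cosyzygyShortComplex R j).X₁ n) :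
      prinj Γ (R.cocomplex.X j) := by
    have : Injective (ModuleCat.of Γ (R.cocomplex.X j)) := R.injective j
    have hinj := Module.injective_module_of_injective_object Γ (R.cocomplex.X j)
    let N : Submodule Γ (R.cocomplex.X j) := LinearMap.ker (R.cocomplex.d j (j + 1)).hom
    have : Module.Finite Γ N := hfin
    have : HasProjectiveDimensionLE (ModuleCat.of Γ N) n := hpd
    exact prinj_of_isEssential k hgl h hinj (hR j)
  have hcosyzygy (j : ℕ) (hj : j ≤ n) : Module.Finite Γ (cosyzygyShortComplex R j).X₁ ∧
      HasProjectiveDimensionLE (cosyzygyShortComplex R j).X₁ j := by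
    induction j with
    | zero =>
      exact ⟨Module.Finite.equiv (kerIso R).symm.toLinearEquiv,
        hasProjectiveDimensionLT_of_iso (kerIso R).symm 1⟩
    | succ j ih =>
      obtain ⟨hfin, hpd⟩ := ih (by lia)
      obtain ⟨hI, hproj, -⟩ :=
        hprinj j hfin (hasProjectiveDimensionLT_of_ge _ (j + 1) (n + 1) (by lia))
      have hS := shortExact_cosyzygyShortComplex R j
      have : Projective (cosyzygyShortComplex R j).X₂ :=
        (IsProjective.iff_projective (R := Γ) (R.cocomplex.X j)).1 hproj
      have : Module.Finite Γ (cosyzygyShortComplex R j).X₂ := hI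
      exact ⟨.of_surjective (cosyzygyShortComplex R j).g.hom
          ((ModuleCat.epi_iff_surjective _).1 hS.epi_g),
        hS.hasProjectiveDimensionLT_X₃ (j + 1) hpd
          (hasProjectiveDimensionLT_of_ge _ 1 (j + 2) (by lia))⟩
  obtain ⟨hfin, hpd⟩ := hcosyzygy j hj
  exact (hprinj j hfin (hasProjectiveDimensionLT_of_ge _ (j + 1) (n + 1) (by lia))).2.1

theorem le_dominantDimension_of_injSoclePdLE_le_prinj (k : Type*) [CommRing k] [IsNoetherianRing k]
    [Algebra k Γ] [Module.Finite k Γ] [IsSemiprimaryRing Γ] {n : ℕ}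
    (hgl : globalDimension Γ ≤ ((n + 1 : ℕ) : WithBot ℕ∞)) (h : injSoclePdLE n Γ ≤ prinj Γ) :
    ((n + 1 : ℕ) : ℕ∞) ≤ dominantDimension Γ := by
  obtain ⟨R, hR⟩ := exists_isMinimalCoresolution (ModuleCat.of Γ Γ)
  have : Module.Finite Γ (ModuleCat.of Γ Γ) := inferInstanceAs (Module.Finite Γ Γ)
  have : Projective (ModuleCat.of Γ Γ) := (IsProjective.iff_projective (R := Γ) Γ).1 inferInstance
  exact natCast_le_dominantDimension_iff.2 ⟨R, hR, fun j hj =>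
    projective_of_isMinimalCoresolution k hgl h hR (Nat.le_of_lt_succ hj)⟩

end DominantDimension

end ArtinAlg

theorem corollary4p2_general (k : Type*) [CommRing k] [IsArtinianRing k]
    (Γ : Type*) [Ring Γ] [Algebra k Γ] [Module.Finite k Γ] (n : ℕ)
    (hgl : ArtinAlg.globalDimension Γ ≤ ((n + 1 : ℕ) : WithBot ℕ∞)) :
    ArtinAlg.IsAuslander n Γ ↔ ArtinAlg.prinj Γ = ArtinAlg.injSoclePdLE n Γ := by
  have : IsArtinianRing Γ := .of_finite k Γ
  exact ⟨fun h => (ArtinAlg.prinj_le_injSoclePdLE hgl).antisymm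
      (ArtinAlg.injSoclePdLE_le_prinj h.2),
    fun h => ⟨hgl, ArtinAlg.le_dominantDimension_of_injSoclePdLE_le_prinj k hgl h.ge⟩⟩

theorem corollary4p2 (k : Type*) [CommRing k] [IsArtinianRing k]
    (Γ : Type*) [Ring Γ] [Algebra k Γ] [Module.Finite k Γ] (n : ℕ)
    (hgl : ArtinAlg.globalDimension Γ = ((n + 1 : ℕ) : WithBot ℕ∞)) :
    ArtinAlg.IsAuslander n Γ ↔ ArtinAlg.prinj Γ = ArtinAlg.injSoclePdLE n Γ :=
  corollary4p2_general k Γ n hgl.le
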